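/- Let $p \ge 4$ and $n$ be integers, and let $D=(V,A)$ be the digraph with $V=\{0,\dots,n\}$ whose arcs are all pairs $(i,j)$ with $i\ne j$, except the arcs entering $0$, the arcs leaving $n$, and the arc $(0,n)$. Let $P^p_{0,n\text{-path}}(D)\subseteq\mathbb{R}^A$ be the $(0,n)$-$p$-path polytope, i.e. the convex hull of the incidence vectors of the simple directed $(0,n)$-paths of $D$ with exactly $p$ arcs. For $S,T\subseteq V$ and $x\in\mathbb{R}^A$ write $x((S:T))=\sum_{(i,j)\in A,\, i\in S,\, j\in T}x_{ij}$. Let $\langle S_0,S_1,\dots,S_p,S_{p+1}\rangle$ be a partition of $V$ with $S_0=\{0\}$ and $S_{p+1}=\{n\}$. If $|S_i|\ge 2$ for $i=1,\dots,p$, then the lifted jump inequality $$\sum_{i=0}^{p-1}\sum_{j=i+2}^{p+1}x((S_i:S_j))-x((S_{p-1}\cup S_p:S_1\cup S_2))\ \ge\ 1$$ is facet defining for $P^p_{0,n\text{-path}}(D)$; that is, it is satisfied by all points of the polytope, and the points of the polytope that satisfy it with equality form a nonempty face of dimension $\dim P^p_{0,n\text{-path}}(D)-1$. -/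

import Mathlib

namespace PathPolytope

/-- The arcs of a digraph, as a type of ordered pairs of nodes. -/
abbrev Arc {V : Type*} (D : Digraph V) : Type _ := {a : V × V // D.Adj a.1 a.2}

/-- `v` lists the nodes of a simple directed `(s,t)`-path of `D` with exactly `p` arcs:
`p + 1` distinct nodes from `s` to `t`, consecutive ones joined by an arc. -/
def IsSimplePath {V : Type*} (D : Digraph V) (s t : V) (p : ℕ) (v : Fin (p + 1) → V) : Prop :=
  Function.Injective v ∧ v 0 = s ∧ v (Fin.last p) = t ∧
    ∀ i : Fin p, D.Adj (v i.castSucc) (v i.succ)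

open Classical in
/-- The incidence vector (indexed by the arcs of `D`) of the path with node sequence `v`. -/
noncomputable def incidence {V : Type*} (D : Digraph V) {p : ℕ} (v : Fin (p + 1) → V) :
    Arc D → ℝ :=
  fun a => if ∃ i : Fin p, v i.castSucc = a.1.1 ∧ v i.succ = a.1.2 then 1 else 0

/-- The `(s,t)`-`p`-path polytope of `D`: the convex hull of the incidence vectors of the simple
directed `(s,t)`-paths of `D` with exactly `p` arcs. -/
noncomputable def pathPolytope {V : Type*} (D : Digraph V) (s t : V) (p : ℕ) :
    Set (Arc D → ℝ) :=
  convexHull ℝ {x | ∃ v : Fin (p + 1) → V, IsSimplePath D s t p v ∧ x = incidence D v}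

/-- The digraph on `{0,…,n}` with all arcs `(i,j)`, `i ≠ j`, except those entering `0`, those
leaving `n`, and `(0,n)`. -/
def baseDigraph (n : ℕ) : Digraph (Fin (n + 1)) where
  Adj i j := i ≠ j ∧ j ≠ 0 ∧ i ≠ Fin.last n ∧ ¬ (i = 0 ∧ j = Fin.last n)

open Classical in
/-- `x((S : T))`, the sum of `x` over the arcs of `D` from `S` to `T`. -/
noncomputable def cut {V : Type*} [Fintype V] (D : Digraph V) (S T : Finset V)
    (x : Arc D → ℝ) : ℝ :=
  ∑ a : Arc D with a.1.1 ∈ S ∧ a.1.2 ∈ T, x a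

/-- The left-hand side of the lifted jump inequality. -/
noncomputable def jumpForm {V : Type*} [Fintype V] [DecidableEq V] (D : Digraph V) (p : ℕ)
    (S : ℕ → Finset V) (x : Arc D → ℝ) : ℝ :=
  (∑ i ∈ Finset.Icc 0 (p - 1), ∑ j ∈ Finset.Icc (i + 2) (p + 1), cut D (S i) (S j) x)
    - cut D (S (p - 1) ∪ S p) (S 1 ∪ S 2) x

/-- `⟨S 0, …, S m⟩` is a partition of the node set `V` (the values of `S` beyond `m` are
not used). -/
def IsOrderedPartition {V : Type*} (m : ℕ) (S : ℕ → Finset V) : Prop :=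
  (∀ i ≤ m, (S i).Nonempty) ∧
  (∀ i ≤ m, ∀ j ≤ m, i ≠ j → Disjoint (S i) (S j)) ∧
  ∀ v : V, ∃ i ≤ m, v ∈ S i

/-- The dimension of a set: the dimension of its affine hull (used for nonempty sets). -/
noncomputable def affDim {E : Type*} [AddCommGroup E] [Module ℝ E] (P : Set E) : ℕ :=
  Module.finrank ℝ (vectorSpan ℝ P)

/-- The inequality `f x ≥ b` is facet defining for `P`: it is valid for `P`, and the face
`{x ∈ P | f x = b}` is nonempty and has dimension `dim P - 1`. -/
def IsFacetDefining {E : Type*} [AddCommGroup E] [Module ℝ E] (P : Set E) (f : E → ℝ)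
    (b : ℝ) : Prop :=
  (∀ x ∈ P, b ≤ f x) ∧ {x ∈ P | f x = b}.Nonempty ∧
    affDim {x ∈ P | f x = b} + 1 = affDim P

end PathPolytope

/-!
Call `lvl v` the index of the class containing the node `v`. On incidence vectors of paths the
left-hand side of the inequality counts the jumps (arcs that climb at least two levels) minus the
returns (arcs from the levels `p - 1`, `p` to the levels `1`, `2`); this is the weight of the
path. A path has to climb `p + 1` levels with `p` arcs, and following the weight and the level
along it shows that the weight is at least `1` (`Layering.one_le_pathSum_weight`).

For the dimension, it suffices that every linear functional which is constant on the paths of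
weight `1` is an affine function of the weight on all paths (`affDim_add_one_eq`,
`Layering.exists_pathSum_eq`). View such a functional as a cost on the arcs. Exchanging single
nodes in paths of weight `1` shows that the costs of the arcs climbing one level come from a
potential (`Layering.exists_potential`). Subtracting this potential, a multiple of the weight and
a multiple of `1 - (lvl y - lvl x)`, whose sum is the same along all paths, one may assume that
the arcs climbing one or two levels and one arc within level `1` are free, and that paths of
weight `1` have total cost `0` (`Layering.Balanced`). Then all arcs are free
(`Layering.Balanced.eq_zero`): paths that climb one level at a time, except that two nodes are
inserted in place of three levels, give relations between three arcs
(`Layering.Balanced.window_eq`), and these are solved for the arcs within a level and jumps of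
three levels, longer jumps, returns, and the other descending arcs, in this order. The longest
jumps need care when `p = 4`, where they can only be determined together with the returns.
-/

namespace PathPolytope

open Finset

/-! ### Layerings and the weight of an arc -/

/-- The partition `⟨S 0, …, S (p + 1)⟩` recorded as a level function: `lvl v = k` means `v ∈ S k`.
The extreme levels are the singletons `{s}` and `{t}`, and every level in between has at least two
nodes, that is, a node different from any prescribed one. -/
structure Layering (V : Type*) (p : ℕ) (s t : V) where
  lvl : V → ℕ
  lvl_eq_zero : ∀ v, lvl v = 0 ↔ v = s
  lvl_eq_top : ∀ v, lvl v = p + 1 ↔ v = t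
  lvl_le : ∀ v, lvl v ≤ p + 1
  exists_ne : ∀ k, 1 ≤ k → k ≤ p → ∀ v, ∃ w, w ≠ v ∧ lvl w = k

namespace Layering

variable {V : Type*} {p : ℕ} {s t : V} (L : Layering V p s t)

/-- The coefficient of the arc `(u, w)` in the jump inequality: `1` for a jump (climbing at least
two levels), `-1` for a return (from one of the levels `p - 1`, `p` to one of the levels `1`,
`2`), `0` otherwise. A return is recognised by `p ≤ lvl u + 1` and `lvl w ≤ 2`, which is correct
on arcs, as these do not leave `t` or enter `s`. -/
def weight (u w : V) : ℤ :=
  (if L.lvl u + 2 ≤ L.lvl w then 1 else 0) - (if p ≤ L.lvl u + 1 ∧ L.lvl w ≤ 2 then 1 else 0)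

/-- The `(s,t)`-paths with `p` arcs, as node sequences on `ℕ` of which only the terms `0, …, p`
matter. Adjacency is not required: in the digraph considered below it follows from injectivity if
`2 ≤ p`. -/
def IsPath (_ : Layering V p s t) (v : ℕ → V) : Prop :=
  Set.InjOn v (Set.Iic p) ∧ v 0 = s ∧ v p = t

/-- The total of the arc costs `g` along the first `p` arcs of `v`. -/
def pathSum {R : Type*} [AddCommMonoid R] (_ : Layering V p s t) (g : V → V → R) (v : ℕ → V) : R :=
  ∑ k ∈ range p, g (v k) (v (k + 1))

theorem lvl_start : L.lvl s = 0 := (L.lvl_eq_zero s).2 rfl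

theorem lvl_end : L.lvl t = p + 1 := (L.lvl_eq_top t).2 rfl

theorem exists_lvl_eq {k : ℕ} (hk : k ≤ p + 1) : ∃ w, L.lvl w = k := by
  rcases Nat.eq_zero_or_pos k with rfl | h0
  · exact ⟨s, L.lvl_start⟩
  · rcases hk.eq_or_lt with rfl | h1
    · exact ⟨t, L.lvl_end⟩
    · obtain ⟨w, -, hw⟩ := L.exists_ne k h0 (by omega) s
      exact ⟨w, hw⟩

theorem exists_lvl_eq_ne {k : ℕ} (h0 : 1 ≤ k) (hk : k ≤ p + 1) {v : V} (hv : L.lvl v ≤ p) :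
    ∃ w, w ≠ v ∧ L.lvl w = k := by
  rcases hk.eq_or_lt with rfl | h1
  · exact ⟨t, by rintro rfl; have := L.lvl_end; omega, L.lvl_end⟩
  · exact L.exists_ne k h0 (by omega) v

theorem weight_of_step (hp : 4 ≤ p) {x y : V} (h : L.lvl y = L.lvl x + 1) : L.weight x y = 0 := by
  unfold weight
  rw [if_neg (by omega), if_neg (by omega)]; rfl

theorem weight_of_jump (hp : 4 ≤ p) {x y : V} (h : L.lvl x + 2 ≤ L.lvl y) : L.weight x y = 1 := by
  have := L.lvl_le y
  unfold weight
  rw [if_pos h, if_neg (by omega)]; rfl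

theorem weight_of_le {x y : V} (h : L.lvl y ≤ L.lvl x + 1) (h' : L.lvl x + 2 ≤ p ∨ 3 ≤ L.lvl y) :
    L.weight x y = 0 := by
  unfold weight
  rw [if_neg (by omega), if_neg (by omega)]; rfl

theorem weight_of_return (hp : 4 ≤ p) {x y : V} (h : p ≤ L.lvl x + 1) (h' : L.lvl y ≤ 2) :
    L.weight x y = -1 := by
  unfold weight
  rw [if_neg (by omega), if_pos ⟨h, h'⟩]; rfl

/-! ### Validity -/

/-- The jump inequality holds on paths. The weight `c` of a prefix with `k` arcs stays
nonnegative, and `c = 0` forces its last node to lie on level at most `k`: a prefix of weight `0`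
cannot use a return before step `p`, and a return which brings the weight back to `0` leads to a
level at most `2`. The whole path has `p` arcs and ends on level `p + 1`. -/
theorem one_le_pathSum_weight (hp : 4 ≤ p) {v : ℕ → V} (hv : L.IsPath v) :
    1 ≤ L.pathSum L.weight v := by
  obtain ⟨-, h0, hpt⟩ := hv
  have key : ∀ k ≤ p, 0 ≤ ∑ i ∈ range k, L.weight (v i) (v (i + 1)) ∧
      (∑ i ∈ range k, L.weight (v i) (v (i + 1)) = 0 → L.lvl (v k) ≤ k) := by
    intro k
    induction k with
    | zero => intro _; simp [h0, L.lvl_start]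
    | succ k ih =>
      intro hk
      obtain ⟨h1, h2⟩ := ih (by omega)
      rw [sum_range_succ]
      generalize ∑ i ∈ range k, L.weight (v i) (v (i + 1)) = c at h1 h2
      have hstart : k = 0 → L.lvl (v k) = 0 := by rintro rfl; rw [h0, L.lvl_start]
      have hend : k + 1 = p → L.lvl (v (k + 1)) = p + 1 := by
        intro h; rw [h, hpt, L.lvl_end]
      unfold weight
      split_ifs <;> omega
  obtain ⟨h1, h2⟩ := key p le_rfl
  have := L.lvl_end
  rw [hpt] at h2
  unfold pathSum
  omega

/-! ### Paths with two inserted nodes -/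

/-- A choice of one node `r k` on every level `k ≤ p + 1`. -/
def IsSection (r : ℕ → V) : Prop := ∀ k ≤ p + 1, L.lvl (r k) = k

/-- The node sequence `r 0, …, r a, u, v, r (a + 4), …, r (p + 1)`: three levels of the section
`r` are left out and two nodes are inserted, which gives a path with `p` arcs. -/
def window (r : ℕ → V) (a : ℕ) (u v : V) (k : ℕ) : V :=
  if k ≤ a then r k else if k = a + 1 then u else if k = a + 2 then v else r (k + 1)

variable {L} in
theorem window_isPath {r : ℕ → V} (hr : L.IsSection r) {a : ℕ} (ha : a + 3 ≤ p) {u v : V}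
    (huv : u ≠ v) (h : ∀ k ≤ p + 1, k ≤ a ∨ a + 4 ≤ k → r k ≠ u ∧ r k ≠ v) :
    L.IsPath (window r a u v) := by
  refine ⟨?_, ?_, ?_⟩
  · have inj : ∀ i ≤ p + 1, ∀ j ≤ p + 1, r i = r j → i = j := by
      intro i hi j hj e
      rw [← hr i hi, ← hr j hj, e]
    intro i hi j hj e
    simp only [Set.mem_Iic] at hi hj
    unfold window at e
    split_ifs at e <;> first
      | omega
      | exact absurd e huv
      | exact absurd e.symm huv
      | exact absurd e (h _ (by omega) (by omega)).1
      | exact absurd e (h _ (by omega) (by omega)).2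
      | exact absurd e.symm (h _ (by omega) (by omega)).1
      | exact absurd e.symm (h _ (by omega) (by omega)).2
      | (have := inj _ (by omega) _ (by omega) e; omega)
  · rw [window, if_pos (Nat.zero_le _), ← L.lvl_eq_zero]
    exact hr 0 (by omega)
  · rw [window, if_neg (by omega), if_neg (by omega), if_neg (by omega), ← L.lvl_eq_top]
    exact hr (p + 1) le_rfl

theorem pathSum_window {R : Type*} [AddCommMonoid R] (g : V → V → R) (r : ℕ → V) {a : ℕ}
    (ha : a + 3 ≤ p) (u v : V) :
    L.pathSum g (window r a u v) = (∑ k ∈ range a, g (r k) (r (k + 1)))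
      + (g (r a) u + g u v + g v (r (a + 4)))
      + ∑ k ∈ range (p - (a + 3)), g (r (a + 4 + k)) (r (a + 4 + k + 1)) := by
  obtain ⟨m, rfl⟩ := Nat.exists_eq_add_of_le ha
  unfold pathSum
  rw [sum_range_add, sum_range_succ, sum_range_succ, sum_range_succ, Nat.add_sub_cancel_left]
  congr 1
  · rw [add_assoc, add_assoc, add_assoc]
    congr 1
    · refine sum_congr rfl fun k hk => ?_
      have := mem_range.1 hk
      rw [window, window, if_pos (by omega), if_pos (by omega)]
    · simp [window, add_assoc]
  · refine sum_congr rfl fun k _ => ?_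
    have e : ∀ j, window r a u v (a + 3 + j) = r (a + 4 + j) := by
      intro j
      rw [window, if_neg (by omega), if_neg (by omega), if_neg (by omega)]
      congr 1; omega
    rw [e, add_assoc (a + 3), e]; rfl

/-- A section through `x` and `y` which avoids `u` and `v` outside the levels strictly between `x`
and `y`. A level has possibly only two nodes, so `u` and `v` must not share a level that is not
skipped. -/
theorem exists_section {a b : ℕ} {x y u v : V} (hx : L.lvl x = a) (hy : L.lvl y = b)
    (hab : a < b) (hu : 1 ≤ L.lvl u ∧ L.lvl u ≤ p) (hv : 1 ≤ L.lvl v ∧ L.lvl v ≤ p)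
    (huv : L.lvl u ≠ L.lvl v ∨ (a < L.lvl u ∧ L.lvl u < b))
    (hxu : x ≠ u) (hxv : x ≠ v) (hyu : y ≠ u) (hyv : y ≠ v) :
    ∃ r, L.IsSection r ∧ r a = x ∧ r b = y ∧
      ∀ k ≤ p + 1, k ≤ a ∨ b ≤ k → r k ≠ u ∧ r k ≠ v := by
  have key : ∀ k, ∃ w, (k ≤ p + 1 → L.lvl w = k) ∧ (k = a → w = x) ∧ (k = b → w = y) ∧
      (k ≤ p + 1 → k ≤ a ∨ b ≤ k → w ≠ u ∧ w ≠ v) := by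
    intro k
    by_cases ka : k = a
    · exact ⟨x, by omega, fun _ => rfl, by omega, fun _ _ => ⟨hxu, hxv⟩⟩
    by_cases kb : k = b
    · exact ⟨y, by omega, by omega, fun _ => rfl, fun _ _ => ⟨hyu, hyv⟩⟩
    by_cases kp : k ≤ p + 1
    swap
    · exact ⟨s, by omega, by omega, by omega, by omega⟩
    obtain ⟨w, hw, hwu⟩ : ∃ w, L.lvl w = k ∧ (k ≤ a ∨ b ≤ k → w ≠ u ∧ w ≠ v) := by
      by_cases k0 : 1 ≤ k ∧ k ≤ p
      · by_cases ku : L.lvl u = k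
        · obtain ⟨w, h1, h2⟩ := L.exists_ne k k0.1 k0.2 u
          exact ⟨w, h2, fun h => ⟨h1, by rintro rfl; omega⟩⟩
        · obtain ⟨w, h1, h2⟩ := L.exists_ne k k0.1 k0.2 v
          exact ⟨w, h2, fun h => ⟨by rintro rfl; omega, h1⟩⟩
      · obtain ⟨w, hw⟩ := L.exists_lvl_eq kp
        exact ⟨w, hw, fun _ => ⟨by rintro rfl; omega, by rintro rfl; omega⟩⟩
    exact ⟨w, fun _ => hw, by omega, by omega, fun _ => hwu⟩
  choose r h1 h2 h3 h4 using key
  exact ⟨r, fun k => h1 k, h2 a rfl, h3 b rfl, fun k => h4 k⟩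

/-! ### Balanced arc costs vanish -/

/-- Arc costs which vanish on all arcs climbing one or two levels, and add up to `0` along every
path of weight `1`. Arcs of cost `0` are called free below. -/
structure Balanced (c : V → V → ℝ) : Prop where
  step : ∀ x y, L.lvl y = L.lvl x + 1 → c x y = 0
  skip : ∀ x y, L.lvl y = L.lvl x + 2 → c x y = 0
  tight : ∀ w, L.IsPath w → L.pathSum L.weight w = 1 → L.pathSum c w = 0

theorem pathSum_window_of_step {R : Type*} [AddCommMonoid R] {g : V → V → R}
    (hg : ∀ x y, L.lvl y = L.lvl x + 1 → g x y = 0) {r : ℕ → V} (hr : L.IsSection r) {a : ℕ}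
    (ha : a + 3 ≤ p) (u v : V) :
    L.pathSum g (window r a u v) = g (r a) u + g u v + g v (r (a + 4)) := by
  rw [L.pathSum_window g r ha, sum_eq_zero, sum_eq_zero, zero_add, add_zero]
  · intro k hk
    have := mem_range.1 hk
    apply hg
    rw [hr _ (by omega), hr _ (by omega)]
  · intro k hk
    have := mem_range.1 hk
    apply hg
    rw [hr _ (by omega), hr _ (by omega)]

namespace Balanced

variable {L} {c : V → V → ℝ}

/-- The basic relation: as the arcs climbing one level cost nothing, a path of weight `1` obtained
by inserting `u`, `v` between levels `a` and `a + 4` gives a relation between three arcs. -/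
theorem window_eq (h : L.Balanced c) (hp : 4 ≤ p) {x u v y : V} (ha : L.lvl x + 3 ≤ p)
    (hy : L.lvl y = L.lvl x + 4) (hu : 1 ≤ L.lvl u ∧ L.lvl u ≤ p)
    (hv : 1 ≤ L.lvl v ∧ L.lvl v ≤ p)
    (hl : L.lvl u ≠ L.lvl v ∨ (L.lvl x < L.lvl u ∧ L.lvl u < L.lvl x + 4)) (huv : u ≠ v)
    (hxu : x ≠ u) (hxv : x ≠ v) (hyu : y ≠ u) (hyv : y ≠ v)
    (hw : L.weight x u + L.weight u v + L.weight v y = 1) :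
    c x u + c u v + c v y = 0 := by
  obtain ⟨r, hr, rx, ry, hav⟩ :=
    L.exists_section (x := x) rfl hy (by omega) hu hv hl hxu hxv hyu hyv
  have h1 := h.tight _ (window_isPath hr ha huv hav)
    (by rw [L.pathSum_window_of_step (fun _ _ => L.weight_of_step hp) hr ha, rx, ry, hw])
  rwa [L.pathSum_window_of_step h.step hr ha, rx, ry] at h1

/-- Inserting one node between levels `a` and `a + 3`. Exactly one of the arcs `(x, u)`, `(u, y)`
is a jump, and neither is a return, since these start above level `a` and end below level `a + 3`.
-/
theorem detour_eq (h : L.Balanced c) (hp : 4 ≤ p) {x u y : V} (ha : L.lvl x + 2 ≤ p)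
    (hy : L.lvl y = L.lvl x + 3) (hu : 1 ≤ L.lvl u ∧ L.lvl u ≤ p) (hxu : x ≠ u) (hyu : y ≠ u) :
    c x u + c u y = 0 := by
  have hw : L.weight x u + L.weight u y = 1 := by
    unfold weight; split_ifs <;> omega
  -- The fourth node of the window continues the path after `y` or, near the top, precedes `x`.
  by_cases hx : L.lvl x + 3 ≤ p
  · obtain ⟨y', hne, hy'⟩ : ∃ y', y' ≠ u ∧ L.lvl y' = L.lvl x + 4 := by
      exact L.exists_lvl_eq_ne (by omega) (by omega) hu.2
    have := h.window_eq hp (x := x) (u := u) (v := y) (y := y') hx hy' hu (by omega) (by omega)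
      hyu.symm hxu (by rintro rfl; omega) hne (by rintro rfl; omega)
      (by rw [L.weight_of_step hp (x := y) (y := y') (by omega), hw]; rfl)
    rwa [h.step y y' (by omega), add_zero] at this
  · obtain ⟨x', hne, hx'⟩ : ∃ x', x' ≠ u ∧ L.lvl x' + 1 = L.lvl x := by
      obtain ⟨x', h1, h2⟩ := L.exists_ne (L.lvl x - 1) (by omega) (by omega) u
      exact ⟨x', h1, by omega⟩
    have := h.window_eq hp (x := x') (u := x) (v := u) (y := y) (by omega) (by omega) (by omega) hu
      (by omega) hxu (by rintro rfl; omega) hne (by rintro rfl; omega) hyu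
      (by rw [L.weight_of_step hp (x := x') (y := x) (by omega), add_assoc, hw]; rfl)
    rwa [h.step x' x (by omega), zero_add] at this

/-- Jumps of three levels and arcs within a level propagate zeros to each other. Because of one
free arc within level `1` all arcs within level `4` are free, hence so are the jumps of three
levels from the levels `0` and `1`; if those from level `a ≥ 1` are free, so are the arcs within
level `a`, and then the jumps of three levels from level `a + 1`. -/
theorem jump_three_eq_zero (h : L.Balanced c) (hp : 4 ≤ p)
    (hf : ∃ x y, L.lvl x = 1 ∧ L.lvl y = 1 ∧ x ≠ y ∧ c x y = 0) {x y : V}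
    (hxy : L.lvl y = L.lvl x + 3) : c x y = 0 := by
  obtain ⟨x₀, x₁, h0, h1, hne, hf⟩ := hf
  have flat4 : ∀ y y', L.lvl y = 4 → L.lvl y' = 4 → y ≠ y' → c y y' = 0 := by
    intro y y' hy hy' hyy
    have e1 := h.detour_eq hp (x := x₀) (u := x₁) (y := y) (by omega) (by omega) (by omega) hne
      (by rintro rfl; omega)
    have e2 := h.detour_eq hp (x := x₁) (u := y) (y := y') (by omega) (by omega) (by omega)
      (by rintro rfl; omega) hyy.symm
    linarith
  have key : ∀ a, ∀ x y, L.lvl x = a → L.lvl y = a + 3 → c x y = 0 := by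
    intro a
    induction a with
    | zero =>
      intro x u hx hu
      obtain ⟨y, -, hy⟩ := L.exists_ne 4 (by omega) hp s
      obtain ⟨v, hvy, hv⟩ := L.exists_ne 4 (by omega) hp y
      have e := h.window_eq hp (x := x) (u := u) (v := v) (y := y) (by omega) (by omega)
        (by omega) (by omega) (by omega) (by rintro rfl; omega) (by rintro rfl; omega)
        (by rintro rfl; omega) (by rintro rfl; omega) hvy.symm
        (by rw [L.weight_of_jump hp (by omega), L.weight_of_step hp (by omega),
              L.weight_of_le (by omega) (by omega)]; rfl)
      rw [h.step u v (by omega), flat4 v y hv hy hvy] at e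
      linarith
    | succ a ih =>
      intro v y hv hy
      have hyp := L.lvl_le y
      rcases Nat.eq_zero_or_pos a with rfl | ha
      · obtain ⟨y', hne, hy'⟩ := L.exists_ne 4 (by omega) hp y
        have e := h.detour_eq hp (x := v) (u := y) (y := y') (by omega) (by omega) (by omega)
          (by rintro rfl; omega) hne
        rw [flat4 y y' (by omega) (by omega) hne.symm] at e
        linarith
      · obtain ⟨u, -, hu⟩ := L.exists_ne a ha (by omega) v
        obtain ⟨x, hxu, hx⟩ := L.exists_ne a ha (by omega) u
        obtain ⟨z, hzu, hz⟩ := L.exists_ne (a + 3) (by omega) (by omega) u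
        have e1 := h.detour_eq hp (x := x) (u := u) (y := z) (by omega) (by omega) (by omega) hxu hzu
        rw [ih u z hu hz] at e1
        have e := h.window_eq hp (x := x) (u := u) (v := v) (y := y) (by omega) (by omega)
          (by omega) (by omega) (by omega) (by rintro rfl; omega) hxu
          (by rintro rfl; omega) (by rintro rfl; omega) (by rintro rfl; omega)
          (by rw [L.weight_of_le (x := x) (by omega) (by omega), L.weight_of_step hp (by omega),
                L.weight_of_jump hp (by omega)]; rfl)
        rw [h.step u v (by omega)] at e
        linarith
  exact key _ x y rfl hxy

/-- An arc within a level forms a detour with a jump of three levels that leaves from that level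
or arrives at it; since `4 ≤ p`, one of the two exists. -/
theorem flat_eq_zero (h : L.Balanced c) (hp : 4 ≤ p)
    (h3 : ∀ x y, L.lvl y = L.lvl x + 3 → c x y = 0) {x y : V} (hl : L.lvl x = L.lvl y)
    (h1 : 1 ≤ L.lvl x) (h2 : L.lvl x ≤ p) (hxy : x ≠ y) : c x y = 0 := by
  by_cases hx : L.lvl x + 2 ≤ p
  · obtain ⟨w, hw⟩ := L.exists_lvl_eq (k := L.lvl x + 3) (by omega)
    have e := h.detour_eq hp (x := x) (u := y) (y := w) hx hw (by omega) hxy (by rintro rfl; omega)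
    rw [h3 y w (by omega)] at e
    linarith
  · obtain ⟨w, hw⟩ := L.exists_lvl_eq (k := L.lvl x - 3) (by omega)
    have e := h.detour_eq hp (x := w) (u := x) (y := y) (by omega) (by omega) (by omega)
      (by rintro rfl; omega) hxy.symm
    rw [h3 w x (by omega)] at e
    linarith

/-- For a jump of four levels, use the window that precedes and follows it by arcs within a level.
For longer ones, replace its tail by a node one level higher: both jumps are balanced by the same
descending arc. -/
theorem inner_jump_eq_zero (h : L.Balanced c) (hp : 4 ≤ p)
    (h3 : ∀ x y, L.lvl y = L.lvl x + 3 → c x y = 0) {x u : V} (h1 : 1 ≤ L.lvl x)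
    (h2 : L.lvl u ≤ p) (hxu : L.lvl x + 4 ≤ L.lvl u) : c x u = 0 := by
  obtain ⟨d, hd⟩ := Nat.exists_eq_add_of_le hxu
  induction d generalizing x with
  | zero =>
    obtain ⟨x', hne, hx'⟩ := L.exists_ne (L.lvl x) h1 (by omega) x
    obtain ⟨y, hyu, hy⟩ := L.exists_ne (L.lvl x + 4) (by omega) (by omega) u
    have e := h.window_eq hp (x := x') (u := x) (v := u) (y := y) (by omega) (by omega)
      (by omega) (by omega) (by omega) (by rintro rfl; omega) hne (by rintro rfl; omega)
      (by rintro rfl; omega) hyu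
      (by rw [L.weight_of_le (x := x') (by omega) (by omega), L.weight_of_jump hp (by omega),
            L.weight_of_le (by omega) (by omega)]; rfl)
    rw [h.flat_eq_zero hp h3 (x := x') (by omega) (by omega) (by omega) hne,
      h.flat_eq_zero hp h3 (x := u) (by omega) (by omega) (by omega) hyu.symm] at e
    linarith
  | succ d ih =>
    obtain ⟨x', hne, hx'⟩ := L.exists_ne (L.lvl x) h1 (by omega) x
    obtain ⟨y, hyu, hy⟩ := L.exists_ne (L.lvl x + 4) (by omega) (by omega) u
    obtain ⟨z, hzu, hz⟩ := L.exists_ne (L.lvl x + 1) (by omega) (by omega) u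
    have e := h.window_eq hp (x := x') (u := x) (v := u) (y := y) (by omega) (by omega)
      (by omega) (by omega) (by omega) (by rintro rfl; omega) hne (by rintro rfl; omega)
      (by rintro rfl; omega) hyu
      (by rw [L.weight_of_le (x := x') (by omega) (by omega), L.weight_of_jump hp (by omega),
            L.weight_of_le (by omega) (by omega)]; rfl)
    have e' := h.detour_eq hp (x := z) (u := u) (y := y) (by omega) (by omega) (by omega) hzu hyu
    rw [h.flat_eq_zero hp h3 (x := x') (by omega) (by omega) (by omega) hne] at e
    rw [ih (x := z) (by omega) (by omega) (by omega)] at e'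
    linarith

/-- The jumps from `s` to level `b` and from level `1` to level `b` are balanced by the same arc
descending to level `4`. -/
theorem jump_start_eq_zero_of_five_le (h : L.Balanced c) (hp : 4 ≤ p)
    (h3 : ∀ x y, L.lvl y = L.lvl x + 3 → c x y = 0) {u : V} (hu : 5 ≤ L.lvl u)
    (hup : L.lvl u ≤ p) : c s u = 0 := by
  have hs := L.lvl_start
  obtain ⟨y, hyu, hy⟩ := L.exists_ne 4 (by omega) (by omega) u
  obtain ⟨y', hyy, hy'⟩ := L.exists_ne 4 (by omega) (by omega) y
  obtain ⟨z, hzu, hz⟩ := L.exists_ne 1 (by omega) (by omega) u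
  have e := h.window_eq hp (x := s) (u := u) (v := y') (y := y) (by omega) (by omega)
    (by omega) (by omega) (by omega) (by rintro rfl; omega) (by rintro rfl; omega)
    (by rintro rfl; omega) hyu hyy.symm
    (by rw [L.weight_of_jump hp (by omega), L.weight_of_le (by omega) (by omega),
          L.weight_of_le (by omega) (by omega)]; rfl)
  have e' := h.detour_eq hp (x := z) (u := u) (y := y') (by omega) (by omega) (by omega) hzu
    (by rintro rfl; omega)
  rw [h.flat_eq_zero hp h3 (x := y') (by omega) (by omega) (by omega) hyy] at e
  rw [h.inner_jump_eq_zero hp h3 (x := z) (by omega) (by omega) (by omega)] at e'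
  linarith

/-- The mirror image of `jump_start_eq_zero_of_five_le`. -/
theorem jump_end_eq_zero_of_add_four_le (h : L.Balanced c) (hp : 4 ≤ p)
    (h3 : ∀ x y, L.lvl y = L.lvl x + 3 → c x y = 0) {v : V} (hv : 1 ≤ L.lvl v)
    (hvp : L.lvl v + 4 ≤ p) : c v t = 0 := by
  have ht := L.lvl_end
  obtain ⟨x, -, hx⟩ := L.exists_ne (p - 3) (by omega) (by omega) s
  obtain ⟨x', hne, hx'⟩ := L.exists_ne (p - 3) (by omega) (by omega) x
  obtain ⟨y, -, hy⟩ := L.exists_ne p (by omega) le_rfl s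
  have e := h.window_eq hp (x := x) (u := x') (v := v) (y := t) (by omega) (by omega)
    (by omega) (by omega) (by omega) (by rintro rfl; omega) hne.symm
    (by rintro rfl; omega) (by rintro rfl; omega) (by rintro rfl; omega)
    (by rw [L.weight_of_le (x := x) (by omega) (by omega), L.weight_of_le (by omega) (by omega),
          L.weight_of_jump hp (by omega)]; rfl)
  have e' := h.detour_eq hp (x := x') (u := v) (y := y) (by omega) (by omega) (by omega)
    (by rintro rfl; omega) (by rintro rfl; omega)
  rw [h.flat_eq_zero hp h3 (x := x) (by omega) (by omega) (by omega) hne.symm] at e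
  rw [h.inner_jump_eq_zero hp h3 (x := v) (by omega) (by omega) (by omega)] at e'
  linarith

/-- A path of weight `1` with two jumps and a return between them. -/
theorem return_window_eq (h : L.Balanced c) (hp : 4 ≤ p) {x u v y : V} (ha : L.lvl x + 3 ≤ p)
    (hy : L.lvl y = L.lvl x + 4) (hu : p ≤ L.lvl u + 1) (hup : L.lvl u ≤ p)
    (hv : 1 ≤ L.lvl v) (hv2 : L.lvl v ≤ 2) (hxu : L.lvl x + 2 ≤ L.lvl u)
    (hvx : L.lvl v ≤ L.lvl x + 2) (hxv : x ≠ v) (hyu : y ≠ u) : c x u + c u v + c v y = 0 :=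
  h.window_eq hp ha hy (by omega) (by omega) (by omega) (by rintro rfl; omega)
    (by rintro rfl; omega) hxv hyu (by rintro rfl; omega)
    (by rw [L.weight_of_jump hp hxu, L.weight_of_return hp hu hv2, L.weight_of_jump hp (by omega)]
        rfl)

/-- The remaining jump from `s`, to level `4`, is followed by a zigzag through level `5` when `5 ≤
p`. When `p = 4` level `5` is `{t}`, and two paths with a common return determine the jump. -/
theorem jump_start_eq_zero (h : L.Balanced c) (hp : 4 ≤ p)
    (h3 : ∀ x y, L.lvl y = L.lvl x + 3 → c x y = 0) {u : V} (hu : 4 ≤ L.lvl u)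
    (hup : L.lvl u ≤ p) : c s u = 0 := by
  have hs := L.lvl_start
  have ht := L.lvl_end
  rcases hu.lt_or_eq with hu | hu
  · exact h.jump_start_eq_zero_of_five_le hp h3 hu hup
  rcases hp.lt_or_eq with h5 | h4
  · obtain ⟨v, hvu, hv⟩ := L.exists_ne 5 (by omega) (by omega) u
    obtain ⟨y, hyu, hy⟩ := L.exists_ne 4 (by omega) (by omega) u
    obtain ⟨z, -, hz⟩ := L.exists_ne 1 (by omega) (by omega) u
    have e := h.window_eq hp (x := s) (u := u) (v := v) (y := y) (by omega) (by omega)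
      (by omega) (by omega) (by omega) hvu.symm (by rintro rfl; omega)
      (by rintro rfl; omega) hyu (by rintro rfl; omega)
      (by rw [L.weight_of_jump hp (by omega), L.weight_of_step hp (by omega),
            L.weight_of_le (by omega) (by omega)]; rfl)
    have e' := h.detour_eq hp (x := z) (u := v) (y := y) (by omega) (by omega) (by omega)
      (by rintro rfl; omega) (by rintro rfl; omega)
    rw [h.inner_jump_eq_zero hp h3 (x := z) (by omega) (by omega) (by omega)] at e'
    rw [h.step u v (by omega)] at e
    linarith
  · obtain ⟨v, -, hv⟩ := L.exists_ne 2 (by omega) (by omega) u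
    obtain ⟨x, -, hx⟩ := L.exists_ne 1 (by omega) (by omega) u
    obtain ⟨y, hyu, hy⟩ := L.exists_ne 4 (by omega) (by omega) u
    have e := h.return_window_eq hp (x := x) (u := u) (v := v) (y := t) (by omega) (by omega)
      (by omega) hup (by omega) (by omega) (by omega) (by omega) (by rintro rfl; omega)
      (by rintro rfl; omega)
    have e' := h.return_window_eq hp (x := s) (u := u) (v := v) (y := y) (by omega) (by omega)
      (by omega) hup (by omega) (by omega) (by omega) (by omega) (by rintro rfl; omega) hyu
    rw [h3 x u (by omega), h3 v t (by omega)] at e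
    rw [h.skip v y (by omega)] at e'
    linarith

/-- The mirror image of `jump_start_eq_zero`. -/
theorem jump_end_eq_zero (h : L.Balanced c) (hp : 4 ≤ p)
    (h3 : ∀ x y, L.lvl y = L.lvl x + 3 → c x y = 0) {v : V} (hv : 1 ≤ L.lvl v)
    (hvp : L.lvl v + 3 ≤ p) : c v t = 0 := by
  have hs := L.lvl_start
  have ht := L.lvl_end
  rcases hvp.lt_or_eq with hvp | hvp
  · exact h.jump_end_eq_zero_of_add_four_le hp h3 hv hvp
  rcases hp.lt_or_eq with h5 | h4
  · obtain ⟨u, -, hu⟩ := L.exists_ne (p - 4) (by omega) (by omega) s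
    obtain ⟨x, hxv, hx⟩ := L.exists_ne (p - 3) (by omega) (by omega) v
    obtain ⟨y, -, hy⟩ := L.exists_ne p (by omega) le_rfl s
    have e := h.window_eq hp (x := x) (u := u) (v := v) (y := t) (by omega) (by omega)
      (by omega) (by omega) (by omega) (by rintro rfl; omega) (by rintro rfl; omega)
      hxv (by rintro rfl; omega) (by rintro rfl; omega)
      (by rw [L.weight_of_le (by omega) (by omega), L.weight_of_step hp (by omega),
            L.weight_of_jump hp (by omega)]; rfl)
    have e' := h.detour_eq hp (x := x) (u := u) (y := y) (by omega) (by omega) (by omega)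
      (by rintro rfl; omega) (by rintro rfl; omega)
    rw [h.inner_jump_eq_zero hp h3 (x := u) (by omega) (by omega) (by omega)] at e'
    rw [h.step u v (by omega)] at e
    linarith
  · obtain ⟨u, -, hu⟩ := L.exists_ne 3 (by omega) (by omega) s
    obtain ⟨x, hxv, hx⟩ := L.exists_ne 1 (by omega) (by omega) v
    obtain ⟨y, -, hy⟩ := L.exists_ne 4 (by omega) (by omega) s
    have e := h.return_window_eq hp (x := s) (u := u) (v := v) (y := y) (by omega) (by omega)
      (by omega) (by omega) (by omega) (by omega) (by omega) (by omega) (by rintro rfl; omega)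
      (by rintro rfl; omega)
    have e' := h.return_window_eq hp (x := x) (u := u) (v := v) (y := t) (by omega) (by omega)
      (by omega) (by omega) (by omega) (by omega) (by omega) (by omega) hxv (by rintro rfl; omega)
    rw [h3 s u (by omega), h3 v y (by omega)] at e
    rw [h.skip x u (by omega)] at e'
    linarith

theorem forward_eq_zero (h : L.Balanced c) (hp : 4 ≤ p)
    (h3 : ∀ x y, L.lvl y = L.lvl x + 3 → c x y = 0) {x y : V} (hxy : L.lvl x < L.lvl y)
    (hst : ¬ (L.lvl x = 0 ∧ L.lvl y = p + 1)) : c x y = 0 := by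
  have hyp := L.lvl_le y
  by_cases d1 : L.lvl y = L.lvl x + 1
  · exact h.step x y d1
  by_cases d2 : L.lvl y = L.lvl x + 2
  · exact h.skip x y d2
  by_cases d3 : L.lvl y = L.lvl x + 3
  · exact h3 x y d3
  by_cases hx : L.lvl x = 0
  · rw [(L.lvl_eq_zero x).1 hx]
    exact h.jump_start_eq_zero hp h3 (by omega) (by omega)
  by_cases hy : L.lvl y = p + 1
  · rw [(L.lvl_eq_top y).1 hy]
    exact h.jump_end_eq_zero hp h3 (by omega) (by omega)
  exact h.inner_jump_eq_zero hp h3 (by omega) (by omega) (by omega)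

/-- Balanced arc costs with a free arc within level `1` vanish on all arcs: the equations of the
face are exhausted by the normalisations made in `Balanced`. Once all ascending arcs are free, a
descending arc is free by a detour through it, or, if it is a return, by a path with two jumps. -/
theorem eq_zero (h : L.Balanced c) (hp : 4 ≤ p)
    (hf : ∃ x y, L.lvl x = 1 ∧ L.lvl y = 1 ∧ x ≠ y ∧ c x y = 0) {x y : V} (hxy : x ≠ y)
    (hx : L.lvl x ≤ p) (hy : 1 ≤ L.lvl y)
    (hst : ¬ (L.lvl x = 0 ∧ L.lvl y = p + 1)) : c x y = 0 := by
  have h3 : ∀ x y, L.lvl y = L.lvl x + 3 → c x y = 0 := fun _ _ => h.jump_three_eq_zero hp hf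
  rcases lt_or_ge (L.lvl x) (L.lvl y) with hlt | hle
  · exact h.forward_eq_zero hp h3 hlt hst
  by_cases hy3 : 3 ≤ L.lvl y
  · obtain ⟨w, hw⟩ := L.exists_lvl_eq (k := L.lvl y - 3) (by omega)
    have e := h.detour_eq hp (x := w) (u := x) (y := y) (by omega) (by omega) (by omega)
      (by rintro rfl; omega) hxy.symm
    rw [h.forward_eq_zero hp h3 (x := w) (y := x) (by omega) (by omega)] at e
    linarith
  by_cases hxp : L.lvl x + 2 ≤ p
  · obtain ⟨w, hw⟩ := L.exists_lvl_eq (k := L.lvl x + 3) (by omega)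
    have e := h.detour_eq hp (x := x) (u := y) (y := w) (by omega) (by omega) (by omega)
      hxy (by rintro rfl; omega)
    rw [h.forward_eq_zero hp h3 (x := y) (y := w) (by omega) (by omega)] at e
    linarith
  obtain ⟨w, hwy, hw⟩ := L.exists_ne 1 le_rfl (by omega) y
  obtain ⟨z, hzx, hz⟩ := L.exists_lvl_eq_ne (k := 5) (by omega) (by omega) hx
  have e := h.return_window_eq hp (x := w) (u := x) (v := y) (y := z) (by omega) (by omega)
    (by omega) hx hy (by omega) (by omega) (by omega) hwy hzx
  rw [h.forward_eq_zero hp h3 (x := w) (y := x) (by omega) (by omega),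
    h.forward_eq_zero hp h3 (x := y) (y := z) (by omega) (by omega)] at e
  linarith

end Balanced

/-! ### Normalising the costs that are constant on the face -/

variable {L} in
theorem window_isPath_of_lvl {r : ℕ → V} (hr : L.IsSection r) {a : ℕ} (ha : a + 3 ≤ p) {u v : V}
    (huv : u ≠ v) (hu : a < L.lvl u ∧ L.lvl u < a + 4) (hv : a < L.lvl v ∧ L.lvl v < a + 4) :
    L.IsPath (window r a u v) :=
  window_isPath hr ha huv fun k hk hka =>
    ⟨by rintro rfl; rw [hr k hk] at hu; omega, by rintro rfl; rw [hr k hk] at hv; omega⟩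

theorem exists_section_through {x y : V} (hxy : L.lvl x < L.lvl y) :
    ∃ r, L.IsSection r ∧ r (L.lvl x) = x ∧ r (L.lvl y) = y := by
  have key : ∀ k, ∃ w, (k ≤ p + 1 → L.lvl w = k) ∧ (k = L.lvl x → w = x) ∧
      (k = L.lvl y → w = y) := by
    intro k
    by_cases ka : k = L.lvl x
    · exact ⟨x, by omega, fun _ => rfl, by omega⟩
    by_cases kb : k = L.lvl y
    · exact ⟨y, by omega, by omega, fun _ => rfl⟩
    by_cases kp : k ≤ p + 1
    · obtain ⟨w, hw⟩ := L.exists_lvl_eq kp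
      exact ⟨w, fun _ => hw, by omega, by omega⟩
    · exact ⟨s, by omega, by omega, by omega⟩
  choose r h1 h2 h3 using key
  exact ⟨r, fun k => h1 k, h2 _ rfl, h3 _ rfl⟩

variable {L}

/-- A node on an inner level may be exchanged for another one of the same level: take a path that
climbs one level before and after it and jumps elsewhere, above if there is room and below
otherwise. -/
theorem add_eq_add_of_lvl_eq {c : V → V → ℝ} {γ : ℝ} (hp : 4 ≤ p)
    (hc : ∀ w, L.IsPath w → L.pathSum L.weight w = 1 → L.pathSum c w = γ) {x u u' y : V}
    (hxu : L.lvl u = L.lvl x + 1) (hu : L.lvl u' = L.lvl u) (huy : L.lvl y = L.lvl u + 1) :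
    c x u + c u y = c x u' + c u' y := by
  have hyp := L.lvl_le y
  have ne : ∀ v w, L.lvl v ≠ L.lvl w → v ≠ w := by rintro v _ h rfl; exact h rfl
  by_cases ha : L.lvl x + 3 ≤ p
  · obtain ⟨z, hz⟩ := L.exists_lvl_eq (k := L.lvl x + 4) (by omega)
    obtain ⟨r, hr, rx, rz⟩ := L.exists_section_through (x := x) (y := z) (by omega)
    rw [hz] at rz
    have key : ∀ v, L.lvl v = L.lvl u → L.pathSum c (window r (L.lvl x) v y) = γ := by
      intro v hv
      refine hc _ (window_isPath_of_lvl hr ha (ne _ _ (by omega)) (by omega) (by omega)) ?_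
      rw [L.pathSum_window_of_step (fun _ _ => L.weight_of_step hp) hr ha, rx, rz,
        L.weight_of_step hp (by omega), L.weight_of_step hp (by omega),
        L.weight_of_jump hp (by omega)]
      rfl
    have e := (key u rfl).trans (key u' hu).symm
    rw [L.pathSum_window c r ha, L.pathSum_window c r ha, rx] at e
    linarith
  · obtain ⟨a, ha'⟩ := Nat.exists_eq_add_of_le (show 2 ≤ L.lvl x by omega)
    obtain ⟨z, hz⟩ := L.exists_lvl_eq (k := a) (by omega)
    obtain ⟨r, hr, -, ry⟩ := L.exists_section_through (x := z) (y := y) (by omega)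
    rw [show L.lvl y = a + 4 by omega] at ry
    have ra := hr a (by omega)
    have key : ∀ v, L.lvl v = L.lvl u → L.pathSum c (window r a x v) = γ := by
      intro v hv
      refine hc _ (window_isPath_of_lvl hr (by omega) (ne _ _ (by omega)) (by omega) (by omega)) ?_
      rw [L.pathSum_window_of_step (fun _ _ => L.weight_of_step hp) hr (by omega), ry,
        L.weight_of_jump hp (by omega), L.weight_of_step hp (by omega),
        L.weight_of_step hp (by omega)]
      rfl
    have e := (key u rfl).trans (key u' hu).symm
    rw [L.pathSum_window c r (by omega), L.pathSum_window c r (by omega), ry] at e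
    linarith

/-- On the arcs climbing one level, costs that are constant on paths of weight `1` come from a
potential: the cost of reaching a node along a fixed section. -/
theorem exists_potential {c : V → V → ℝ} {γ : ℝ} (hp : 4 ≤ p)
    (hc : ∀ w, L.IsPath w → L.pathSum L.weight w = 1 → L.pathSum c w = γ) :
    ∃ π : V → ℝ, ∀ x y, L.lvl y = L.lvl x + 1 → c x y = π y - π x := by
  obtain ⟨r, hr, -, -⟩ := L.exists_section_through (x := s) (y := t)
    (by rw [L.lvl_start, L.lvl_end]; omega)
  refine ⟨fun y => if L.lvl y = 0 then 0 else
    ∑ k ∈ range (L.lvl y - 1), c (r k) (r (k + 1)) + c (r (L.lvl y - 1)) y, fun x y hxy => ?_⟩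
  have hyp := L.lvl_le y
  have hrx := hr (L.lvl x) (by omega)
  simp only [hxy, Nat.add_sub_cancel]
  rw [if_neg (by omega)]
  rcases Nat.eq_zero_or_pos (L.lvl x) with h0 | h0
  · rw [if_pos h0, h0]
    rw [h0] at hrx
    rw [(L.lvl_eq_zero _).1 hrx, (L.lvl_eq_zero _).1 h0]
    simp
  · rw [if_neg (by omega)]
    obtain ⟨m, hm⟩ := Nat.exists_eq_add_of_le h0
    have hrm := hr m (by omega)
    rw [show L.lvl x = m + 1 by omega] at hrx ⊢
    rw [sum_range_succ, Nat.add_sub_cancel]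
    have := add_eq_add_of_lvl_eq hp hc (x := r m) (u := r (m + 1)) (u' := x) (y := y) (by omega)
      (by omega) (by omega)
    linarith

/-- The costs `c` after subtraction of a potential difference, of `α` times the deficit `1 - (lvl
y - lvl x)`, and of `μ` times the weight. The first two have the same sum along all paths. -/
def reduce (L : Layering V p s t) (c : V → V → ℝ) (π : V → ℝ) (α μ : ℝ) (x y : V) : ℝ :=
  c x y - (π y - π x) - α * (1 - ((L.lvl y : ℝ) - L.lvl x)) - μ * L.weight x y

theorem pathSum_reduce (c : V → V → ℝ) (π : V → ℝ) (α μ : ℝ) {w : ℕ → V} (hw : L.IsPath w) :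
    L.pathSum (L.reduce c π α μ) w =
      L.pathSum c w - (π t - π s) + α - μ * (L.pathSum L.weight w : ℤ) := by
  obtain ⟨-, h0, hp⟩ := hw
  have e1 := sum_range_sub (fun k => π (w k)) p
  have e2 := sum_range_sub (fun k => (L.lvl (w k) : ℝ)) p
  simp only [h0, hp, L.lvl_start, L.lvl_end] at e1 e2
  simp only [pathSum, reduce, sum_sub_distrib, ← mul_sum, sum_const, card_range, nsmul_eq_mul]
  rw [sum_sub_distrib] at e1 e2
  rw [e1, e2]
  push_cast
  ring

/-- If arcs climbing one level are free, a jump of two levels is the only costly arc of a path of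
weight `1`. -/
theorem eq_of_lvl_eq_add_two {c : V → V → ℝ} {γ : ℝ} (hp : 4 ≤ p)
    (h0 : ∀ x y, L.lvl y = L.lvl x + 1 → c x y = 0)
    (hc : ∀ w, L.IsPath w → L.pathSum L.weight w = 1 → L.pathSum c w = γ) {x y : V}
    (hxy : L.lvl y = L.lvl x + 2) : c x y = γ := by
  have hyp := L.lvl_le y
  have ne : ∀ v w, L.lvl v ≠ L.lvl w → v ≠ w := by rintro v _ h rfl; exact h rfl
  by_cases ha : L.lvl x + 3 ≤ p
  · obtain ⟨v, hv⟩ := L.exists_lvl_eq (k := L.lvl x + 3) (by omega)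
    obtain ⟨r, hr, rx, -⟩ := L.exists_section_through (x := x) (y := y) (by omega)
    have rz := hr (L.lvl x + 4) (by omega)
    have e := hc _ (window_isPath_of_lvl hr ha (ne y v (by omega)) (by omega) (by omega)) (by
      rw [L.pathSum_window_of_step (fun _ _ => L.weight_of_step hp) hr ha, rx,
        L.weight_of_jump hp (by omega), L.weight_of_step hp (by omega),
        L.weight_of_step hp (by omega)]
      rfl)
    rw [L.pathSum_window_of_step h0 hr ha, rx, h0 y v (by omega), h0 v _ (by omega)] at e
    linarith
  · obtain ⟨a, ha'⟩ := Nat.exists_eq_add_of_le (show 2 ≤ L.lvl x by omega)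
    obtain ⟨u, hu⟩ := L.exists_lvl_eq (k := a + 1) (by omega)
    obtain ⟨r, hr, -, ry⟩ := L.exists_section_through (x := x) (y := y) (by omega)
    rw [show L.lvl y = a + 4 by omega] at ry
    have ra := hr a (by omega)
    have e := hc _ (window_isPath_of_lvl (a := a) hr (by omega) (ne u x (by omega)) (by omega)
      (by omega)) (by
        rw [L.pathSum_window_of_step (fun _ _ => L.weight_of_step hp) hr (by omega), ry,
          L.weight_of_step hp (by omega), L.weight_of_step hp (by omega),
          L.weight_of_jump hp (by omega)]
        rfl)
    rw [L.pathSum_window_of_step h0 hr (by omega), ry, h0 _ u (by omega), h0 u x (by omega)] at e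
    linarith

/-- Arc costs that are constant on the paths of weight `1` are, on all paths, an affine function
of the weight. -/
theorem exists_pathSum_eq {c : V → V → ℝ} {γ : ℝ} (hp : 4 ≤ p)
    (hc : ∀ w, L.IsPath w → L.pathSum L.weight w = 1 → L.pathSum c w = γ) :
    ∃ κ μ : ℝ, ∀ w, L.IsPath w → L.pathSum c w = κ + μ * (L.pathSum L.weight w : ℤ) := by
  obtain ⟨π, hπ⟩ := exists_potential hp hc
  obtain ⟨x₀, -, hx₀⟩ := L.exists_ne 1 le_rfl (by omega) s
  obtain ⟨x₁, hne, hx₁⟩ := L.exists_ne 1 le_rfl (by omega) x₀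
  have hc1 : ∀ w, L.IsPath w → L.pathSum L.weight w = 1 →
      L.pathSum (L.reduce c π 0 0) w = γ - (π t - π s) := by
    intro w hw h1
    rw [pathSum_reduce c π 0 0 hw, hc w hw h1]; ring
  have hstep : ∀ x y, L.lvl y = L.lvl x + 1 → L.reduce c π 0 0 x y = 0 := by
    intro x y hxy
    rw [reduce, hπ x y hxy]; ring
  -- `α` is chosen to free the arc `(x₀, x₁)`, and then `μ` to free the jumps of two levels.
  set α := L.reduce c π 0 0 x₀ x₁ with hα
  set μ := γ - (π t - π s) + α with hμ
  have hbal : L.Balanced (L.reduce c π α μ) := by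
    refine ⟨fun x y hxy => ?_, fun x y hxy => ?_, fun w hw h1 => ?_⟩
    · rw [reduce, hπ x y hxy, L.weight_of_step hp hxy, hxy]
      push_cast; ring
    · have h2 := eq_of_lvl_eq_add_two hp hstep hc1 hxy
      have hw : L.weight x y = 1 := L.weight_of_jump hp (by omega)
      rw [reduce, hxy, hw] at *
      push_cast at *
      linarith
    · rw [pathSum_reduce c π α μ hw, hc w hw h1, h1]
      push_cast
      linarith
  have hflat : L.reduce c π α μ x₀ x₁ = 0 := by
    have : L.weight x₀ x₁ = 0 := L.weight_of_le (by omega) (by omega)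
    rw [reduce, hx₀, hx₁, this, hα, reduce]
    push_cast; ring
  refine ⟨π t - π s - α, μ, fun w hw => ?_⟩
  have hz : L.pathSum (L.reduce c π α μ) w = 0 := by
    refine sum_eq_zero fun k hk => ?_
    have hk := mem_range.1 hk
    obtain ⟨inj, h0, hp'⟩ := hw
    have hle : ∀ k < p, L.lvl (w k) ≤ p := by
      intro k hk
      by_contra hcon
      have := (L.lvl_eq_top (w k)).1 (by have := L.lvl_le (w k); omega)
      have := inj (Set.mem_Iic.2 hk.le) (Set.mem_Iic.2 le_rfl) (this.trans hp'.symm)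
      omega
    have hge : ∀ k ≤ p, 0 < k → 1 ≤ L.lvl (w k) := by
      intro k hk hk0
      by_contra hcon
      have := (L.lvl_eq_zero (w k)).1 (by omega)
      have := inj (Set.mem_Iic.2 hk) (Set.mem_Iic.2 (Nat.zero_le _)) (this.trans h0.symm)
      omega
    refine hbal.eq_zero hp ⟨x₀, x₁, hx₀, hx₁, hne.symm, hflat⟩ (fun e => ?_) (hle k hk)
      (hge _ (by omega) (by omega)) ?_
    · have := inj (Set.mem_Iic.2 hk.le) (Set.mem_Iic.2 hk) e
      omega
    · rintro ⟨e1, e2⟩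
      have : k = 0 := by
        by_contra hcon
        have := hge k hk.le (by omega)
        omega
      have := hle (k + 1)
      omega
  rw [pathSum_reduce c π α μ hw] at hz
  linarith

theorem exists_isPath_pathSum_weight_eq_one (hp : 4 ≤ p) :
    ∃ w, L.IsPath w ∧ L.pathSum L.weight w = 1 := by
  obtain ⟨r, hr, -, -⟩ := L.exists_section_through (x := s) (y := t)
    (by rw [L.lvl_start, L.lvl_end]; omega)
  have h0 := hr 0 (by omega)
  have h1 := hr 1 (by omega)
  have h2 := hr 2 (by omega)
  have h4 : L.lvl (r (0 + 4)) = 4 := hr 4 (by omega)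
  refine ⟨window r 0 (r 1) (r 2), window_isPath_of_lvl hr (by omega) (fun e => ?_) (by omega)
    (by omega), ?_⟩
  · rw [e] at h1; omega
  · rw [L.pathSum_window_of_step (fun _ _ => L.weight_of_step hp) hr (by omega),
      L.weight_of_step hp (by omega), L.weight_of_step hp (by omega),
      L.weight_of_jump hp (by omega)]
    rfl

theorem exists_isPath_pathSum_weight_eq_two (hp : 4 ≤ p) :
    ∃ w, L.IsPath w ∧ L.pathSum L.weight w = 2 := by
  obtain ⟨r, hr, -, -⟩ := L.exists_section_through (x := s) (y := t)
    (by rw [L.lvl_start, L.lvl_end]; omega)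
  have h0 := hr 0 (by omega)
  have h4 : L.lvl (r (0 + 4)) = 4 := hr 4 (by omega)
  obtain ⟨u, -, hu⟩ := L.exists_ne 2 (by omega) (by omega) s
  obtain ⟨v, hvu, hv⟩ := L.exists_ne 2 (by omega) (by omega) u
  refine ⟨window r 0 u v, window_isPath_of_lvl hr (by omega) hvu.symm (by omega) (by omega), ?_⟩
  rw [L.pathSum_window_of_step (fun _ _ => L.weight_of_step hp) hr (by omega),
      L.weight_of_jump hp (by omega), L.weight_of_le (by omega) (by omega),
      L.weight_of_jump hp (by omega)]
  rfl

end Layering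
/-! ### Facets and linear functionals -/

/-- A criterion for facets: if some point of `P` lies on the hyperplane `f = b` and some point
does not, and every linear functional constant on the face `{x ∈ P | f x = b}` is an affine
function of `f` on `P`, then the face has codimension one. -/
theorem affDim_add_one_eq {E : Type*} [AddCommGroup E] [Module ℝ E] [FiniteDimensional ℝ E]
    {P : Set E} (f : E →ₗ[ℝ] ℝ) {b : ℝ} (h0 : {x ∈ P | f x = b}.Nonempty)
    (h1 : ∃ x ∈ P, f x ≠ b)
    (h : ∀ φ : E →ₗ[ℝ] ℝ, ∀ γ : ℝ, (∀ x ∈ P, f x = b → φ x = γ) →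
      ∃ κ μ : ℝ, ∀ x ∈ P, φ x = κ + μ * f x) :
    affDim {x ∈ P | f x = b} + 1 = affDim P := by
  obtain ⟨x₀, hx₀, hfx₀⟩ := h0
  obtain ⟨x₁, hx₁, hfx₁⟩ := h1
  set U := vectorSpan ℝ P with hU
  have hW : vectorSpan ℝ {x ∈ P | f x = b} = U ⊓ LinearMap.ker f := by
    apply le_antisymm
    · refine le_inf (vectorSpan_mono ℝ fun x hx => hx.1) ?_
      rw [vectorSpan_def, Submodule.span_le]
      rintro _ ⟨x, ⟨-, hx⟩, y, ⟨-, hy⟩, rfl⟩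
      simp [hx, hy]
    · rintro z ⟨hzU, hzf⟩
      by_contra hz
      obtain ⟨φ, hφz, hφ⟩ := Submodule.exists_le_ker_of_notMem hz
      obtain ⟨κ, μ, hφP⟩ := h φ (φ x₀) fun x hx hxb => by
        have := hφ (vsub_mem_vectorSpan ℝ (p₁ := x) (p₂ := x₀) ⟨hx, hxb⟩ ⟨hx₀, hfx₀⟩)
        simpa [sub_eq_zero] using this
      have hle : U ≤ LinearMap.ker (φ - μ • f) := by
        rw [hU, vectorSpan_def, Submodule.span_le]
        rintro _ ⟨x, hx, y, hy, rfl⟩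
        simp [hφP x hx, hφP y hy]
        ring
      have hz0 := hle hzU
      have hzf : f z = 0 := hzf
      apply hφz
      simpa [hzf] using hz0
  -- Rank and nullity of `f` restricted to the direction space of `P`.
  have hne : f.domRestrict U ≠ 0 := by
    intro hzero
    have := LinearMap.congr_fun hzero ⟨_, vsub_mem_vectorSpan ℝ hx₁ hx₀⟩
    simp [sub_eq_zero, hfx₀] at this
    exact hfx₁ this
  have hker : Module.finrank ℝ (U ⊓ LinearMap.ker f : Submodule ℝ E) =
      Module.finrank ℝ (LinearMap.ker (f.domRestrict U)) := by
    rw [LinearMap.ker_domRestrict, ← Submodule.map_comap_subtype]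
    exact (Submodule.finrank_map_subtype_eq U _)
  have hrank := LinearMap.finrank_range_add_finrank_ker (f.domRestrict U)
  rw [LinearMap.range_eq_top.2 (LinearMap.surjective hne), finrank_top, Module.finrank_self] at hrank
  rw [affDim, affDim, hW, hker, ← hU]
  omega

/-! ### Functionals on the path polytope -/

open Classical in
/-- The linear functional on `ℝ^A` with coefficients `g` on the arcs. -/
noncomputable def arcSum {V : Type*} [Fintype V] (D : Digraph V) (g : V → V → ℝ) :
    (Arc D → ℝ) →ₗ[ℝ] ℝ :=
  ∑ a : Arc D, g a.1.1 a.1.2 • LinearMap.proj a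

/-- The sum may be taken for any enumeration of the arcs, in particular for that of `cut`. -/
theorem arcSum_apply {V : Type*} [Fintype V] {D : Digraph V} [Fintype (Arc D)] (g : V → V → ℝ)
    (x : Arc D → ℝ) : arcSum D g x = ∑ a : Arc D, g a.1.1 a.1.2 * x a := by
  rw [arcSum, LinearMap.sum_apply]
  convert rfl
  rfl

theorem exists_eq_arcSum {V : Type*} [Fintype V] (D : Digraph V) (φ : (Arc D → ℝ) →ₗ[ℝ] ℝ) :
    ∃ g, φ = arcSum D g := by
  classical
  refine ⟨fun u w => if h : D.Adj u w then φ (Pi.single ⟨(u, w), h⟩ 1) else 0, ?_⟩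
  refine LinearMap.pi_ext' fun a => LinearMap.ext_ring ?_
  rw [LinearMap.comp_apply, LinearMap.comp_apply, arcSum_apply, Finset.sum_eq_single a]
  · simp [a.2]
  · intro b _ hb
    simp [hb]
  · simp

theorem arcSum_incidence {V : Type*} [Fintype V] {D : Digraph V} {s t : V} {p : ℕ}
    {v : Fin (p + 1) → V} (hv : IsSimplePath D s t p v) (g : V → V → ℝ) :
    arcSum D g (incidence D v) = ∑ i : Fin p, g (v i.castSucc) (v i.succ) := by
  classical
  obtain ⟨inj, -, -, hadj⟩ := hv
  let e : Fin p → Arc D := fun i => ⟨(v i.castSucc, v i.succ), hadj i⟩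
  have he : Function.Injective e := by
    intro i j hij
    have h1 : v i.castSucc = v j.castSucc := congrArg (fun a : Arc D => a.1.1) hij
    exact Fin.castSucc_injective p (inj h1)
  rw [arcSum_apply]
  symm
  apply Finset.sum_of_injOn e he.injOn (by simp)
  · intro a _ ha
    rw [incidence, if_neg, mul_zero]
    rintro ⟨i, h1, h2⟩
    exact ha ⟨i, by simp, Subtype.ext (Prod.ext h1 h2)⟩
  · intro i _
    rw [incidence, if_pos ⟨i, rfl, rfl⟩, mul_one]

theorem cut_eq_sum_ite {V : Type*} [Fintype V] [DecidableEq V] {D : Digraph V} [Fintype (Arc D)]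
    (S T : Finset V) (x : Arc D → ℝ) :
    cut D S T x = ∑ a : Arc D, if a.1.1 ∈ S ∧ a.1.2 ∈ T then x a else 0 := by
  rw [cut, Finset.sum_filter]
  convert rfl

theorem exists_layering {n p : ℕ} {S : ℕ → Finset (Fin (n + 1))}
    (hS : IsOrderedPartition (p + 1) S) (hS0 : S 0 = {0}) (hSlast : S (p + 1) = {Fin.last n})
    (hcard : ∀ i, 1 ≤ i → i ≤ p → 2 ≤ (S i).card) :
    ∃ L : Layering (Fin (n + 1)) p 0 (Fin.last n),
      ∀ v, ∀ i ≤ p + 1, v ∈ S i ↔ L.lvl v = i := by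
  obtain ⟨-, hdisj, hcov⟩ := hS
  choose l hl hmem using hcov
  have key : ∀ v, ∀ i ≤ p + 1, v ∈ S i ↔ l v = i := by
    intro v i hi
    refine ⟨fun h => ?_, fun h => h ▸ hmem v⟩
    by_contra hne
    exact disjoint_left.1 (hdisj _ (hl v) _ hi hne) (hmem v) h
  refine ⟨⟨l, fun v => ?_, fun v => ?_, hl, fun k h1 hk v => ?_⟩, key⟩
  · rw [← key v 0 (by omega), hS0, mem_singleton]
  · rw [← key v (p + 1) le_rfl, hSlast, mem_singleton]
  · obtain ⟨w, hw, hwv⟩ := exists_mem_ne (hcard k h1 hk) v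
    exact ⟨w, hwv, (key w k (by omega)).1 hw⟩

theorem Layering.isPath_extend {n p : ℕ} (L : Layering (Fin (n + 1)) p 0 (Fin.last n))
    {v : Fin (p + 1) → Fin (n + 1)}
    (hv : IsSimplePath (baseDigraph n) 0 (Fin.last n) p v) :
    ∃ w, L.IsPath w ∧ ∀ i : Fin (p + 1), v i = w i := by
  obtain ⟨inj, h0, hp, -⟩ := hv
  refine ⟨fun k => if h : k < p + 1 then v ⟨k, h⟩ else 0, ⟨?_, ?_, ?_⟩, ?_⟩
  · intro i hi j hj hij
    simp only [Set.mem_Iic] at hi hj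
    simp only [dif_pos (Nat.lt_succ_of_le hi), dif_pos (Nat.lt_succ_of_le hj)] at hij
    simpa using inj hij
  · simpa using h0
  · exact (dif_pos p.lt_succ_self).trans hp
  · intro i
    simp only [dif_pos i.2]

theorem Layering.IsPath.isSimplePath {n p : ℕ} {L : Layering (Fin (n + 1)) p 0 (Fin.last n)}
    (hp : 2 ≤ p) {w : ℕ → Fin (n + 1)} (hw : L.IsPath w) :
    IsSimplePath (baseDigraph n) 0 (Fin.last n) p (fun i => w i) := by
  obtain ⟨inj, h0, hpt⟩ := hw
  have inj' : ∀ i ≤ p, ∀ j ≤ p, w i = w j → i = j := fun i hi j hj h => inj hi hj h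
  refine ⟨fun i j h => ?_, h0, by simpa using hpt, fun i => ?_⟩
  · exact Fin.ext (inj' i (by omega) j (by omega) h)
  · have hi := i.2
    simp only [baseDigraph, Fin.val_castSucc, Fin.val_succ]
    refine ⟨fun h => ?_, fun h => ?_, fun h => ?_, fun h => ?_⟩
    · have := inj' i (by omega) (i + 1) (by omega) h
      omega
    · have := inj' (i + 1) (by omega) 0 (by omega) (h.trans h0.symm)
      omega
    · have := inj' i (by omega) p (by omega) (h.trans hpt.symm)
      omega
    · have h1 := inj' i (by omega) 0 (by omega) (h.1.trans h0.symm)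
      have h2 := inj' (i + 1) (by omega) p (by omega) (h.2.trans hpt.symm)
      omega

theorem jumpForm_eq_arcSum {n p : ℕ} (hp : 4 ≤ p) {S : ℕ → Finset (Fin (n + 1))}
    (L : Layering (Fin (n + 1)) p 0 (Fin.last n))
    (hL : ∀ v, ∀ i ≤ p + 1, v ∈ S i ↔ L.lvl v = i) (x : Arc (baseDigraph n) → ℝ) :
    jumpForm (baseDigraph n) p S x =
      arcSum (baseDigraph n) (fun u w => (L.weight u w : ℝ)) x := by
  classical
  simp only [jumpForm, cut_eq_sum_ite, arcSum_apply]
  have hcomm : ∑ i ∈ Icc 0 (p - 1), ∑ j ∈ Icc (i + 2) (p + 1),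
      ∑ a : Arc (baseDigraph n), (if a.1.1 ∈ S i ∧ a.1.2 ∈ S j then x a else 0) =
      ∑ a : Arc (baseDigraph n), if L.lvl a.1.1 + 2 ≤ L.lvl a.1.2 then x a else 0 := by
    simp_rw [Finset.sum_comm (s := Icc _ (p + 1)) (t := (univ : Finset (Arc (baseDigraph n))))]
    rw [Finset.sum_comm]
    refine sum_congr rfl fun a _ => ?_
    have hin : ∀ i ∈ Icc 0 (p - 1), ∑ j ∈ Icc (i + 2) (p + 1),
        (if a.1.1 ∈ S i ∧ a.1.2 ∈ S j then x a else 0) =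
        if L.lvl a.1.1 = i then (if L.lvl a.1.1 + 2 ≤ L.lvl a.1.2 then x a else 0) else 0 := by
      intro i hi
      rw [mem_Icc] at hi
      rw [sum_congr rfl (g := fun j => if L.lvl a.1.2 = j then
        (if L.lvl a.1.1 = i then x a else 0) else 0), sum_ite_eq]
      · have := L.lvl_le a.1.2
        simp only [mem_Icc]
        split_ifs <;> first | rfl | omega
      · intro j hj
        rw [mem_Icc] at hj
        simp only [hL _ i (show i ≤ p + 1 by omega), hL _ j hj.2]
        split_ifs <;> first | rfl | omega
    rw [sum_congr rfl hin, sum_ite_eq]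
    have := L.lvl_le a.1.2
    simp only [mem_Icc]
    split_ifs <;> first | rfl | omega
  rw [hcomm, ← sum_sub_distrib]
  refine sum_congr rfl fun a _ => ?_
  have h1 : 1 ≤ L.lvl a.1.2 := by
    by_contra hcon
    exact a.2.2.1 ((L.lvl_eq_zero _).1 (by omega))
  have h2 : L.lvl a.1.1 ≤ p := by
    by_contra hcon
    exact a.2.2.2.1 ((L.lvl_eq_top _).1 (by have := L.lvl_le a.1.1; omega))
  have hret : (a.1.1 ∈ S (p - 1) ∪ S p ∧ a.1.2 ∈ S 1 ∪ S 2) ↔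
      (p ≤ L.lvl a.1.1 + 1 ∧ L.lvl a.1.2 ≤ 2) := by
    rw [mem_union, mem_union, hL _ _ (by omega), hL _ _ (by omega), hL _ _ (by omega),
      hL _ _ (by omega)]
    omega
  simp only [hret, Layering.weight]
  split_ifs <;> simp

end PathPolytope

/-! ### The facet -/

theorem mainTheorem4 (n p : ℕ) (hp : 4 ≤ p) (S : ℕ → Finset (Fin (n + 1)))
    (hS : PathPolytope.IsOrderedPartition (p + 1) S)
    (hS0 : S 0 = {0}) (hSlast : S (p + 1) = {Fin.last n})
    (hcard : ∀ i, 1 ≤ i → i ≤ p → 2 ≤ (S i).card) :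
    PathPolytope.IsFacetDefining
      (PathPolytope.pathPolytope (PathPolytope.baseDigraph n) 0 (Fin.last n) p)
      (PathPolytope.jumpForm (PathPolytope.baseDigraph n) p S) 1 := by
  open PathPolytope Layering in
  obtain ⟨L, hL⟩ := exists_layering hS hS0 hSlast hcard
  set D := baseDigraph n with hD
  set f := arcSum D (fun u w => (L.weight u w : ℝ)) with hf
  have hJ : jumpForm D p S = f := funext fun x => jumpForm_eq_arcSum hp L hL x
  rw [hJ]
  have hval : ∀ (g : Fin (n + 1) → Fin (n + 1) → ℝ) {w}, L.IsPath w →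
      arcSum D g (incidence D fun i : Fin (p + 1) => w i) = L.pathSum g w := by
    intro g w hw
    rw [arcSum_incidence (hw.isSimplePath (by omega)), pathSum, Finset.sum_range]
    simp
  have hweight : ∀ {w}, L.IsPath w →
      f (incidence D fun i : Fin (p + 1) => w i) = (L.pathSum L.weight w : ℤ) := by
    intro w hw
    rw [hf, hval _ hw, pathSum, pathSum]
    push_cast
    rfl
  have hmem : ∀ {w}, L.IsPath w → (incidence D fun i : Fin (p + 1) => w i) ∈
      pathPolytope D 0 (Fin.last n) p := fun hw =>
    subset_convexHull ℝ _ ⟨_, hw.isSimplePath (by omega), rfl⟩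
  have hpath : ∀ {C : Set (Arc D → ℝ)}, Convex ℝ C →
      (∀ {w}, L.IsPath w → (incidence D fun i : Fin (p + 1) => w i) ∈ C) →
      pathPolytope D 0 (Fin.last n) p ⊆ C := by
    intro C hC h
    refine convexHull_min ?_ hC
    rintro _ ⟨v, hv, rfl⟩
    obtain ⟨w, hw, hvw⟩ := L.isPath_extend hv
    rw [funext hvw]
    exact h hw
  obtain ⟨w₁, hw₁, hw₁f⟩ := L.exists_isPath_pathSum_weight_eq_one hp
  obtain ⟨w₂, hw₂, hw₂f⟩ := L.exists_isPath_pathSum_weight_eq_two hp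
  have hne : {x ∈ pathPolytope D 0 (Fin.last n) p | f x = 1}.Nonempty :=
    ⟨_, hmem hw₁, by rw [hweight hw₁, hw₁f]; norm_num⟩
  refine ⟨fun x hx => ?_, hne, affDim_add_one_eq f hne ⟨_, hmem hw₂, ?_⟩ fun φ γ hφ => ?_⟩
  · refine hpath (convex_halfSpace_ge f.isLinear 1) (fun hw => ?_) hx
    rw [Set.mem_ofPred_eq, hweight hw]
    exact_mod_cast L.one_le_pathSum_weight hp hw
  · rw [hweight hw₂, hw₂f]; norm_num
  · obtain ⟨g, rfl⟩ := exists_eq_arcSum D φ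
    obtain ⟨κ, μ, h⟩ := exists_pathSum_eq (L := L) (c := g) (γ := γ) hp fun w hw h1 => by
      rw [← hval g hw]
      exact hφ _ (hmem hw) (by rw [hweight hw, h1]; norm_num)
    refine ⟨κ, μ, fun x hx => ?_⟩
    have := hpath (C := {x | (arcSum D g - μ • f) x = κ})
      (convex_hyperplane (arcSum D g - μ • f).isLinear κ) (fun hw => ?_) hx
    · simp only [Set.mem_ofPred_eq, LinearMap.sub_apply, LinearMap.smul_apply, smul_eq_mul] at this
      linarith
    · simp [hweight hw, hval g hw, h _ hw]
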